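/- **Theorem 2.** A *task* for two processes is a triple $\Pi=(\mathcal I,\mathcal O,\Delta)$, where $\mathcal I$ is a finite set of input configurations $X=(x_1,x_2)$, $\mathcal O$ is a finite set of output configurations $Y=(y_1,y_2)$ (the values are arbitrary), and $\Delta$ assigns to every $X\in\mathcal I$ a set $\Delta(X)\subseteq\mathcal O$ of legal output configurations. Two asynchronous processes $p_1,p_2$, which are deterministic, possibly infinite, state machines, communicate by atomic reads and writes in shared registers; each $p_i$ has one register $R_i$, with a fixed initial content, that it alone can write and that both processes can read. Process $p_i$ starts with the private input $x_i$ and may halt by deciding a private output. An execution is an arbitrary interleaving of the steps of the two processes, each of which may crash, i.e. stop taking steps, at any time. An algorithm *solves $\Pi$ wait-free* if, for every $X\in\mathcal I$ and in every execution with inputs $X$, (i) every process that does not crash decides after finitely many steps, no matter what the other process does, and (ii) at every time there is some $(y_1,y_2)\in\Delta(X)$ such that each process $p_i$ that has decided has decided $y_i$ (in particular, if both have decided, the pair of their outputs belongs to $\Delta(X)$). Consider two models. * *Unbounded registers*: $R_1,R_2$ can hold values from an arbitrary set. * *1-bit registers with input registers*: $R_1,R_2$ hold one bit each, initially $0$;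 in addition, each $p_i$ has a write-once input register $I_i$, initially empty ($\bot$). The first step of $p_i$ writes its input $x_i$ in $I_i$; after that $I_i$ is never written again, and both processes can read $I_1$ and $I_2$ at any time. Then every task for two processes that is solvable wait-free with unbounded registers is solvable wait-free with 1-bit registers with input registers. -/

import Mathlib

universe u v w x

/-- A task for `n` processes, with private inputs in `In` and private outputs in `Out`: a finite set
of input configurations, a finite set of output configurations, and a map `Δ` that gives, for every
input configuration, the set of output configurations that are legal for it (the values of `Δ`
outside `inputs` are irrelevant). -/
structure DistTask (n : ℕ) (In : Type u) (Out : Type v) where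
  inputs : Set (Fin n → In)
  outputs : Set (Fin n → Out)
  Δ : (Fin n → In) → Set (Fin n → Out)
  inputs_finite : inputs.Finite
  outputs_finite : outputs.Finite
  Δ_subset : ∀ σ ∈ inputs, Δ σ ⊆ outputs

/-- An asynchronous system of `n` deterministic processes: global configurations, the initial
configuration for given private inputs, the effect of one atomic step of process `i`, and the value
that process `i` has decided in a configuration (`none` if it has not decided). -/
structure AsyncSystem (n : ℕ) (In : Type u) (Out : Type v) where
  Config : Type w
  start : (Fin n → In) → Config
  step : Fin n → Config → Config
  output : Fin n → Config → Option Out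

namespace AsyncSystem

variable {n : ℕ} {In : Type u} {Out : Type v}

/-- The configuration after the first `t` steps of the execution with inputs `σ` in which the `k`-th
step is taken by process `ρ k`. A process crashes in `ρ` if it occurs only finitely often. -/
def exec (S : AsyncSystem.{u, v, w} n In Out) (σ : Fin n → In) (ρ : ℕ → Fin n) : ℕ → S.Config
  | 0 => S.start σ
  | t + 1 => S.step (ρ t) (S.exec σ ρ t)

/-- In the configuration `c`, the values decided so far are compatible with an output configuration
that is legal for the input configuration `σ`; if all processes have decided, this says that their
outputs form a legal output configuration. -/
def Legal (S : AsyncSystem.{u, v, w} n In Out) (P : DistTask n In Out) (σ : Fin n → In)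
    (c : S.Config) : Prop :=
  ∃ τ ∈ P.Δ σ, ∀ i a, S.output i c = some a → τ i = a

/-- The system solves the task wait-free: for every input configuration of the task and for all
interleavings and crashes, the decided values are always legal, and every process that does not
crash decides (whatever the other processes do). -/
def SolvesWaitFree (S : AsyncSystem.{u, v, w} n In Out) (P : DistTask n In Out) : Prop :=
  ∀ σ ∈ P.inputs, ∀ ρ : ℕ → Fin n,
    (∀ t, S.Legal P σ (S.exec σ ρ t)) ∧
    ∀ i, (∀ t, ∃ t', t ≤ t' ∧ ρ t' = i) → ∃ t a, S.output i (S.exec σ ρ t) = some a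

end AsyncSystem

/-! ### Single-writer multi-reader registers -/

/-- What a process does next: halt with a private output value, write a value in its own register
and go to the state `s`, or read the register of process `j` and go to a state that depends on the
value read. -/
inductive RegOp (n : ℕ) (Out : Type v) (V : Type x) (State : Type w)
  | decide (a : Out)
  | write (b : V) (s : State)
  | read (j : Fin n) (f : V → State)

/-- An algorithm for `n` processes that communicate through one register per process with values in
`V`: each process is a (possibly infinite) deterministic state machine. -/
structure RegAlgorithm (n : ℕ) (In : Type u) (Out : Type v) (V : Type x) where
  State : Type w
  init : Fin n → In → State
  op : Fin n → State → RegOp n Out V State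

/-- A global configuration: the contents of the registers and the local states. -/
structure RegConfig (n : ℕ) (V : Type x) (State : Type w) where
  reg : Fin n → V
  loc : Fin n → State

namespace RegAlgorithm

variable {n : ℕ} {In : Type u} {Out : Type v} {V : Type x}

/-- One atomic step of process `i`; a process that has decided has halted, and does nothing. -/
def step (A : RegAlgorithm.{u, v, w, x} n In Out V) (i : Fin n) (c : RegConfig n V A.State) :
    RegConfig n V A.State :=
  match A.op i (c.loc i) with
  | .decide _ => c
  | .write b s => { reg := Function.update c.reg i b, loc := Function.update c.loc i s }
  | .read j f => { c with loc := Function.update c.loc i (f (c.reg j)) }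

/-- The value decided by process `i`, if any. -/
def output (A : RegAlgorithm.{u, v, w, x} n In Out V) (i : Fin n) (c : RegConfig n V A.State) :
    Option Out :=
  match A.op i (c.loc i) with
  | .decide a => some a
  | _ => none

/-- The system that runs the algorithm with initial register contents `r₀`. -/
def toSystem (A : RegAlgorithm.{u, v, w, x} n In Out V) (r₀ : Fin n → V) :
    AsyncSystem n In Out where
  Config := RegConfig n V A.State
  start σ := { reg := r₀, loc := fun i => A.init i (σ i) }
  step := A.step
  output := A.output

end RegAlgorithm

/-- Wait-free solvability with unbounded-size registers: there is no restriction on the type `V` of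
the values that a register can hold. -/
def DistTask.SolvableUnbounded {n : ℕ} {In : Type u} {Out : Type v} (P : DistTask n In Out) : Prop :=
  ∃ (V : Type x) (r₀ : Fin n → V) (A : RegAlgorithm.{u, v, w, x} n In Out V),
    (A.toSystem r₀).SolvesWaitFree P

/-! ### Registers with additional write-once input registers -/

/-- What a process does next, in the presence of input registers. They can be read, the value `none`
meaning that nothing was written yet, but the program of a process has no instruction to write in
them: the input is written by the first step of the process, and never again. -/
inductive InputRegOp (n : ℕ) (In : Type u) (Out : Type v) (V : Type x) (State : Type w)
  | decide (a : Out)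
  | write (b : V) (s : State)
  | read (j : Fin n) (f : V → State)
  | readInput (j : Fin n) (f : Option In → State)

/-- An algorithm for `n` processes that communicate through one register per process with values in
`V` and one write-once input register per process. -/
structure InputRegAlgorithm (n : ℕ) (In : Type u) (Out : Type v) (V : Type x) where
  State : Type w
  init : Fin n → In → State
  op : Fin n → State → InputRegOp n In Out V State

/-- A global configuration: the contents of the registers, of the input registers, and the local
states; `Sum.inl a` is the local state of a process with private input `a` that has not taken its
first step. -/
structure InputRegConfig (n : ℕ) (In : Type u) (V : Type x) (State : Type w) where
  reg : Fin n → V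
  inp : Fin n → Option In
  loc : Fin n → In ⊕ State

namespace InputRegAlgorithm

variable {n : ℕ} {In : Type u} {Out : Type v} {V : Type x}

/-- One atomic step of process `i`. The first step writes the private input in the input register of
the process. -/
def step (A : InputRegAlgorithm.{u, v, w, x} n In Out V) (i : Fin n)
    (c : InputRegConfig n In V A.State) : InputRegConfig n In V A.State :=
  match c.loc i with
  | .inl a =>
    { c with
      inp := Function.update c.inp i (some a)
      loc := Function.update c.loc i (.inr (A.init i a)) }
  | .inr s =>
    match A.op i s with
    | .decide _ => c
    | .write b s' =>
      { c with
        reg := Function.update c.reg i b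
        loc := Function.update c.loc i (.inr s') }
    | .read j f => { c with loc := Function.update c.loc i (.inr (f (c.reg j))) }
    | .readInput j f => { c with loc := Function.update c.loc i (.inr (f (c.inp j))) }

/-- The value decided by process `i`, if any. -/
def output (A : InputRegAlgorithm.{u, v, w, x} n In Out V) (i : Fin n)
    (c : InputRegConfig n In V A.State) : Option Out :=
  match c.loc i with
  | .inl _ => none
  | .inr s =>
    match A.op i s with
    | .decide a => some a
    | _ => none

/-- The system that runs the algorithm with initial register contents `r₀` and empty input
registers. -/
def toSystem (A : InputRegAlgorithm.{u, v, w, x} n In Out V) (r₀ : Fin n → V) :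
    AsyncSystem n In Out where
  Config := InputRegConfig n In V A.State
  start σ := { reg := r₀, inp := fun _ => none, loc := fun i => .inl (σ i) }
  step := A.step
  output := A.output

end InputRegAlgorithm

/-- Wait-free solvability with one 1-bit register per process, initially `0`, and one write-once
input register per process. -/
def DistTask.SolvableOneBit {n : ℕ} {In : Type u} {Out : Type v} (P : DistTask n In Out) : Prop :=
  ∃ A : InputRegAlgorithm.{u, v, w, 0} n In Out Bool,
    (A.toSystem fun _ => false).SolvesWaitFree P

/-! Fix an input configuration and join an output of one process to an output of the other when
together they are legal. For a wait-free algorithm, the outputs of the two solo executions from the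
start are connected in this graph (`SolvesFrom.soloConnected`). Indeed a read is invisible to the
other process and writes in distinct registers commute, so disconnected solo outputs cannot all
become connected within the next steps (`soloConnected_of_step`). Disconnectedness would thus stay
reachable along an infinite execution. But once a process has decided, the solo outputs are legal
together, so nobody would ever decide in that execution.

Conversely, such a path is all that the 1-bit registers need. In `parityAlgorithm` the processes
write alternating bits round by round, and each stops when the other's bit differs from its own.
Only the parity of a round is visible, yet the halting rounds differ by exactly one or both equal `L
+ 1` (`Compatible.next`). The path, lengthened to `2 * L + 3` edges, is folded in the middle so that
the possible pairs of halting rounds become edges of it (`exists_outputTable`). Round `0` receives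
the solo outputs: a process that halts there knows only its own input, and its solo output depends
on nothing else. -/

namespace AsyncSystem

variable {n : ℕ} {In : Type u} {Out : Type v}

/-! ### Executions from arbitrary configurations, and solo outputs -/

/-- The configuration after `t` steps of the execution that starts in `c`. -/
def run (S : AsyncSystem.{u, v, w} n In Out) (c : S.Config) (ρ : ℕ → Fin n) : ℕ → S.Config
  | 0 => c
  | t + 1 => S.step (ρ t) (S.run c ρ t)

theorem run_start (S : AsyncSystem.{u, v, w} n In Out) (σ : Fin n → In) (ρ : ℕ → Fin n) (t : ℕ) :
    S.run (S.start σ) ρ t = S.exec σ ρ t := by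
  induction t with
  | zero => rfl
  | succ t ih => simp only [run, exec, ih]

theorem run_const (S : AsyncSystem.{u, v, w} n In Out) (c : S.Config) (i : Fin n) (t : ℕ) :
    S.run c (fun _ => i) t = (S.step i)^[t] c := by
  induction t with
  | zero => rfl
  | succ t ih => rw [run, ih, Function.iterate_succ_apply']

/-- The schedule that starts with a step of `i` and goes on as `ρ`. -/
def consSchedule (i : Fin n) (ρ : ℕ → Fin n) : ℕ → Fin n
  | 0 => i
  | t + 1 => ρ t

theorem run_consSchedule (S : AsyncSystem.{u, v, w} n In Out) (c : S.Config) (i : Fin n)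
    (ρ : ℕ → Fin n) (t : ℕ) : S.run c (consSchedule i ρ) (t + 1) = S.run (S.step i c) ρ t := by
  induction t with
  | zero => rfl
  | succ t ih => rw [run, ih]; rfl

/-- Decisions are irrevocable. -/
def Irrevocable (S : AsyncSystem.{u, v, w} n In Out) : Prop :=
  ∀ i j c a, S.output i c = some a → S.output i (S.step j c) = some a

/-- All executions from the configuration `c` are wait-free and legal. -/
def SolvesFrom (S : AsyncSystem.{u, v, w} n In Out) (P : DistTask n In Out) (σ : Fin n → In)
    (c : S.Config) : Prop :=
  ∀ ρ : ℕ → Fin n, (∀ t, S.Legal P σ (S.run c ρ t)) ∧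
    ∀ i, (∀ t, ∃ t', t ≤ t' ∧ ρ t' = i) → ∃ t a, S.output i (S.run c ρ t) = some a

/-- Process `i` decides `a` if it runs alone from `c`. -/
def SoloDecides (S : AsyncSystem.{u, v, w} n In Out) (i : Fin n) (c : S.Config) (a : Out) : Prop :=
  ∃ k, S.output i ((S.step i)^[k] c) = some a

variable {S : AsyncSystem.{u, v, w} n In Out} {P : DistTask n In Out} {σ : Fin n → In}
  {c : S.Config}

theorem SolvesWaitFree.solvesFrom_start (h : S.SolvesWaitFree P) (hσ : σ ∈ P.inputs) :
    S.SolvesFrom P σ (S.start σ) := by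
  intro ρ
  simpa only [run_start] using h σ hσ ρ

theorem SolvesFrom.step (hS : S.Irrevocable) (h : S.SolvesFrom P σ c) (i : Fin n) :
    S.SolvesFrom P σ (S.step i c) := by
  intro ρ
  obtain ⟨h1, h2⟩ := h (consSchedule i ρ)
  refine ⟨fun t => ?_, fun j hj => ?_⟩
  · rw [← run_consSchedule]
    exact h1 _
  · obtain ⟨t, a, ha⟩ := h2 j fun t => by
      obtain ⟨t', ht, e⟩ := hj t
      exact ⟨t' + 1, by omega, e⟩
    refine ⟨t, a, ?_⟩
    rw [← run_consSchedule]
    -- The decision is known after `t` steps of the longer execution; irrevocability moves it on by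
    -- one step.
    exact hS _ _ _ _ ha

theorem SolvesFrom.legal_iterate (h : S.SolvesFrom P σ c) (i : Fin n) (k : ℕ) :
    S.Legal P σ ((S.step i)^[k] c) := by
  rw [← run_const]
  exact (h _).1 k

theorem SolvesFrom.exists_soloDecides (h : S.SolvesFrom P σ c) (i : Fin n) :
    ∃ a, S.SoloDecides i c a := by
  obtain ⟨t, a, ha⟩ := (h fun _ => i).2 i fun t => ⟨t, le_rfl, rfl⟩
  rw [run_const] at ha
  exact ⟨a, t, ha⟩

theorem Irrevocable.output_iterate (hS : S.Irrevocable) {i : Fin n} {a : Out}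
    (h : S.output i c = some a) (j : Fin n) (k : ℕ) :
    S.output i ((S.step j)^[k] c) = some a := by
  induction k with
  | zero => exact h
  | succ k ih =>
    rw [Function.iterate_succ_apply']
    exact hS _ _ _ _ ih

theorem Irrevocable.output_run (hS : S.Irrevocable) {i : Fin n} {a : Out} {ρ : ℕ → Fin n} {t : ℕ}
    (h : S.output i (S.run c ρ t) = some a) (k : ℕ) :
    S.output i (S.run c ρ (t + k)) = some a := by
  induction k with
  | zero => exact h
  | succ k ih => exact hS _ _ _ _ ih

theorem Irrevocable.soloDecides_unique (hS : S.Irrevocable) {i : Fin n} {a b : Out}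
    (ha : S.SoloDecides i c a) (hb : S.SoloDecides i c b) : a = b := by
  obtain ⟨k, hk⟩ := ha
  obtain ⟨l, hl⟩ := hb
  have h1 := hS.output_iterate hk i l
  have h2 := hS.output_iterate hl i k
  rw [← Function.iterate_add_apply] at h1 h2
  rw [add_comm, h2] at h1
  exact (Option.some.inj h1).symm

theorem Irrevocable.soloDecides_step (hS : S.Irrevocable) {i : Fin n} {a : Out}
    (h : S.SoloDecides i c a) : S.SoloDecides i (S.step i c) a := by
  obtain ⟨k, hk⟩ := h
  refine ⟨k, ?_⟩
  rw [← Function.iterate_succ_apply, Function.iterate_succ_apply']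
  exact hS _ _ _ _ hk

end AsyncSystem

/-! ### Connectivity of solo outputs -/

/-- The graph of the pairs (process, output) in which the outputs of the two processes are adjacent
if together they form a configuration in `D`. -/
def outputGraph {Out : Type v} (D : Set (Fin 2 → Out)) : SimpleGraph (Fin 2 × Out) where
  Adj p q := p.1 ≠ q.1 ∧ ∃ τ ∈ D, τ p.1 = p.2 ∧ τ q.1 = q.2
  symm := ⟨fun _ _ ⟨h, τ, hτ, h1, h2⟩ => ⟨h.symm, τ, hτ, h2, h1⟩⟩
  loopless := ⟨fun _ h => h.1 rfl⟩

namespace AsyncSystem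

variable {In : Type u} {Out : Type v} {S : AsyncSystem.{u, v, w} 2 In Out} {P : DistTask 2 In Out}
  {σ : Fin 2 → In} {c : S.Config}

/-- The outputs of the two solo executions from `c` are connected by legal configurations. -/
def SoloConnected (S : AsyncSystem.{u, v, w} 2 In Out) (P : DistTask 2 In Out) (σ : Fin 2 → In)
    (c : S.Config) : Prop :=
  ∀ a b, S.SoloDecides 0 c a → S.SoloDecides 1 c b → (outputGraph (P.Δ σ)).Reachable (0, a) (1, b)

/-- The decided value is that process's solo output. Letting the other process run alone then yields
a configuration in which both solo outputs are decided, and its legality is a single edge. -/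
theorem SolvesFrom.soloConnected_of_output (hS : S.Irrevocable) (h : S.SolvesFrom P σ c)
    {i : Fin 2} {x : Out} (hx : S.output i c = some x) : S.SoloConnected P σ c := by
  rintro a b ha hb
  have key : ∃ d, S.Legal P σ d ∧ S.output 0 d = some a ∧ S.output 1 d = some b := by
    match i with
    | 0 =>
      obtain rfl := hS.soloDecides_unique ha ⟨0, hx⟩
      obtain ⟨k, hk⟩ := hb
      exact ⟨_, h.legal_iterate 1 k, hS.output_iterate hx 1 k, hk⟩
    | 1 =>
      obtain rfl := hS.soloDecides_unique hb ⟨0, hx⟩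
      obtain ⟨k, hk⟩ := ha
      exact ⟨_, h.legal_iterate 0 k, hk, hS.output_iterate hx 0 k⟩
  obtain ⟨d, ⟨τ, hτ, hd⟩, h0, h1⟩ := key
  exact SimpleGraph.Adj.reachable ⟨by simp, τ, hτ, hd 0 a h0, hd 1 b h1⟩

/-- The solo outputs are connected if no execution can preserve disconnectedness for ever. -/
theorem SolvesFrom.soloConnected (hS : S.Irrevocable) (h : S.SolvesFrom P σ c)
    (hstep : ∀ d, S.SolvesFrom P σ d → (∀ i, S.SoloConnected P σ (S.step i d)) →
      S.SoloConnected P σ (S.step 1 (S.step 0 d)) → S.SoloConnected P σ d) :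
    S.SoloConnected P σ c := by
  by_contra hc
  -- `hstep` may locate a disconnected configuration only two steps ahead, so the property that
  -- propagates is to have a disconnected descendant, not to be disconnected.
  let Bad : S.Config → Prop := fun d =>
    S.SolvesFrom P σ d ∧ ∃ ρ t, ¬ S.SoloConnected P σ (S.run d ρ t)
  have solves_run : ∀ d, S.SolvesFrom P σ d → ∀ ρ t, S.SolvesFrom P σ (S.run d ρ t) := by
    intro d hd ρ t
    induction t with
    | zero => exact hd
    | succ t ih => exact ih.step hS _
  have undecided : ∀ d, Bad d → ∀ i, S.output i d = none := by
    rintro d ⟨hd, ρ, t, hb⟩ i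
    by_contra hne
    obtain ⟨x, hx⟩ := Option.ne_none_iff_exists'.1 hne
    have hx' : S.output i (S.run d ρ 0) = some x := hx
    have := hS.output_run hx' t
    rw [zero_add] at this
    exact hb ((solves_run d hd ρ t).soloConnected_of_output hS this)
  have next : ∀ d, Bad d → ∃ i, Bad (S.step i d) := by
    rintro d ⟨hd, ρ, t, hb⟩
    by_contra! hno
    have good : ∀ i ρ t, S.SoloConnected P σ (S.run (S.step i d) ρ t) := fun i ρ t => by
      by_contra hg
      exact hno i ⟨hd.step hS i, ρ, t, hg⟩
    have hgood : S.SoloConnected P σ d :=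
      hstep d hd (fun i => good i (fun _ => 0) 0) (good 0 (fun _ => 1) 1)
    cases t with
    | zero => exact hb hgood
    | succ t =>
      apply hb
      have e : ρ = consSchedule (ρ 0) (fun k => ρ (k + 1)) := by
        funext k
        cases k <;> rfl
      rw [e, run_consSchedule]
      exact good _ _ _
  choose! f hf using next
  let D : ℕ → S.Config := fun t => (fun d => S.step (f d) d)^[t] c
  have hD : ∀ t, D (t + 1) = S.step (f (D t)) (D t) := fun t => Function.iterate_succ_apply' _ _ _
  have hbad : ∀ t, Bad (D t) := by
    intro t
    induction t with
    | zero => exact ⟨h, fun _ => 0, 0, hc⟩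
    | succ t ih =>
      rw [hD]
      exact hf _ ih
  have hrun : ∀ t, S.run c (fun t => f (D t)) t = D t := by
    intro t
    induction t with
    | zero => rfl
    | succ t ih => rw [hD, run, ih]
  have hinf : ∃ i, ∀ t, ∃ t', t ≤ t' ∧ f (D t') = i := by
    by_contra! hno
    obtain ⟨t0, h0⟩ := hno 0
    obtain ⟨t1, h1⟩ := hno 1
    have e0 := h0 (max t0 t1) (le_max_left _ _)
    have e1 := h1 (max t0 t1) (le_max_right _ _)
    omega
  obtain ⟨i, hi⟩ := hinf
  obtain ⟨t, a, ha⟩ := (h fun t => f (D t)).2 i hi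
  rw [hrun, undecided _ (hbad t) i] at ha
  cases ha

end AsyncSystem

/-! ### Reads are invisible and writes commute -/

namespace RegAlgorithm

variable {n : ℕ} {In : Type u} {Out : Type v} {V : Type x}

theorem irrevocable (A : RegAlgorithm.{u, v, w, x} n In Out V) (r₀ : Fin n → V) :
    (A.toSystem r₀).Irrevocable := by
  intro i j c a h
  change A.output i c = some a at h
  change A.output i (A.step j c) = some a
  by_cases hij : i = j
  · subst hij
    have e : A.step i c = c := by
      unfold output at h
      unfold step
      split at h
      · next e => rw [e]
      · cases h
    rwa [e]
  · have e : (A.step j c).loc i = c.loc i := by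
      unfold step
      split <;> simp [Function.update_of_ne hij]
    unfold output at h ⊢
    rwa [e]

/-- A solo execution depends only on the registers and on the local state of the process. -/
theorem soloDecides_congr (A : RegAlgorithm.{u, v, w, x} n In Out V) (r₀ : Fin n → V) {i : Fin n}
    {c d : RegConfig n V A.State} (hreg : c.reg = d.reg) (hloc : c.loc i = d.loc i) {a : Out}
    (h : (A.toSystem r₀).SoloDecides i c a) : (A.toSystem r₀).SoloDecides i d a := by
  obtain ⟨k, hk⟩ := h
  refine ⟨k, ?_⟩
  change A.output i ((A.step i)^[k] c) = some a at hk
  change A.output i ((A.step i)^[k] d) = some a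
  have key : ((A.step i)^[k] c).reg = ((A.step i)^[k] d).reg ∧
      ((A.step i)^[k] c).loc i = ((A.step i)^[k] d).loc i := by
    clear hk
    induction k with
    | zero => exact ⟨hreg, hloc⟩
    | succ k ih =>
      rw [Function.iterate_succ_apply', Function.iterate_succ_apply']
      obtain ⟨h1, h2⟩ := ih
      generalize (A.step i)^[k] c = c' at h1 h2
      generalize (A.step i)^[k] d = d' at h1 h2
      unfold step
      rw [← h2, ← h1]
      cases A.op i (c'.loc i) <;> simp [h1, h2]
  unfold output at hk ⊢
  rwa [← key.2]

variable {A : RegAlgorithm.{u, v, w, x} 2 In Out V} {r₀ : Fin 2 → V} {P : DistTask 2 In Out}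
  {σ : Fin 2 → In}

/-- A step of a process does not change its own solo output. If the step is a read, it does not
change the other solo output either, so connectivity after the step is enough. Only two writes need
the configuration after both steps. -/
theorem soloConnected_of_step (c : RegConfig 2 V A.State)
    (h : (A.toSystem r₀).SolvesFrom P σ c)
    (hs : ∀ i, (A.toSystem r₀).SoloConnected P σ (A.step i c))
    (hss : (A.toSystem r₀).SoloConnected P σ (A.step 1 (A.step 0 c))) :
    (A.toSystem r₀).SoloConnected P σ c := by
  have hI := A.irrevocable r₀
  intro a b ha hb
  have ha0 : (A.toSystem r₀).SoloDecides 0 (A.step 0 c) a := hI.soloDecides_step ha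
  have hb1 : (A.toSystem r₀).SoloDecides 1 (A.step 1 c) b := hI.soloDecides_step hb
  have dec : ∀ i y, A.op i (c.loc i) = .decide y →
      (outputGraph (P.Δ σ)).Reachable (0, a) (1, b) := fun i y hy =>
    h.soloConnected_of_output hI (i := i) (x := y) (by simp [toSystem, output, hy]) a b ha hb
  match e0 : A.op 0 (c.loc 0), e1 : A.op 1 (c.loc 1) with
  | .decide y, _ => exact dec 0 y e0
  | _, .decide y => exact dec 1 y e1
  | .read j f, _ =>
    exact hs 0 a b ha0 (A.soloDecides_congr r₀ (by simp [step, e0]) (by simp [step, e0]) hb)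
  | _, .read j f =>
    exact hs 1 a b (A.soloDecides_congr r₀ (by simp [step, e1]) (by simp [step, e1]) ha) hb1
  | .write v s, .write v' s' =>
    have hcomm : A.step 1 (A.step 0 c) = A.step 0 (A.step 1 c) := by
      simp only [step, e0, e1, Function.update_of_ne (show (1 : Fin 2) ≠ 0 by simp),
        Function.update_of_ne (show (0 : Fin 2) ≠ 1 by simp)]
      congr 1 <;> exact Function.update_comm (by simp) _ _ _
    have h0 : (A.toSystem r₀).SolvesFrom P σ (A.step 0 c) := h.step hI 0
    have h1 : (A.toSystem r₀).SolvesFrom P σ (A.step 1 c) := h.step hI 1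
    obtain ⟨b', hb'⟩ := h0.exists_soloDecides 1
    obtain ⟨a', ha'⟩ := h1.exists_soloDecides 0
    -- The path runs from `a` to `b'` after the write of process 0, from `b'` to `a'` after both
    -- writes, and from `a'` to `b` after the write of process 1.
    refine (hs 0 a b' ha0 hb').trans (.trans (.symm (hss a' b' ?_ (hI.soloDecides_step hb')))
      (hs 1 a' b ha' hb1))
    rw [hcomm]
    exact hI.soloDecides_step ha'

end RegAlgorithm

/-! ### Tables of outputs by halting round -/

/-- A labelled path of odd length in the output graph gives a table of outputs, indexed by process
and round, in which rounds that differ by one, and the last round twice, are legal together. -/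
theorem exists_outputTable {Out : Type v} {D : Set (Fin 2 → Out)} {a b : Out}
    (h : (outputGraph D).Reachable (0, a) (1, b)) :
    ∃ (L : ℕ) (y : Fin 2 → ℕ → Option Out), y 0 0 = some a ∧ y 1 0 = some b ∧
      ∀ r q, r ≤ L + 1 → q ≤ L + 1 → (r = q + 1 ∨ q = r + 1 ∨ (r = L + 1 ∧ q = L + 1)) →
        ∃ τ ∈ D, y 0 r = some (τ 0) ∧ y 1 q = some (τ 1) := by
  obtain ⟨p⟩ := h
  have parity : ∀ w : (outputGraph D).Walk (0, a) (1, b), ∀ j ≤ w.length,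
      (w.getVert j).1.val = j % 2 := by
    intro w j hj
    induction j with
    | zero => simp
    | succ j ih =>
      have h1 := ih (by omega)
      have h2 := (w.adj_getVert_succ (i := j) (by omega)).1
      omega
  obtain ⟨L, w, hw⟩ : ∃ (L : ℕ) (w : (outputGraph D).Walk (0, a) (1, b)),
      w.length = 2 * L + 3 := by
    have hp := parity p p.length le_rfl
    rw [p.getVert_length] at hp
    change 1 = p.length % 2 at hp
    -- The length of `p` is odd but may be 1; going forth, back and forth triples it, which gives an
    -- odd length of at least 3.
    refine ⟨(3 * p.length - 3) / 2, (p.append p.reverse).append p, ?_⟩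
    rw [SimpleGraph.Walk.length_append, SimpleGraph.Walk.length_append,
      SimpleGraph.Walk.length_reverse]
    omega
  -- Round `r` stands for the `r`-th vertices from the two ends; as the length is odd, exactly one
  -- of them belongs to process `i`. In round `L + 1` they are the two middle vertices, hence
  -- adjacent.
  let pos : Fin 2 → ℕ → ℕ := fun i r => if r % 2 = i.val then r else 2 * L + 3 - r
  refine ⟨L, fun i r => some (w.getVert (pos i r)).2, ?_, ?_, ?_⟩
  · simp [pos]
  · simp [pos, ← hw]
  · intro r q hr hq hrq
    have h0 : pos 0 r ≤ 2 * L + 3 := by simp only [pos]; split <;> omega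
    have h1 : pos 1 q ≤ 2 * L + 3 := by simp only [pos]; split <;> omega
    have p0 : pos 0 r % 2 = 0 := by
      simp only [pos, Fin.val_zero]; split <;> omega
    have p1 : pos 1 q % 2 = 1 := by
      simp only [pos, Fin.val_one]; split <;> omega
    have hstep : pos 0 r + 1 = pos 1 q ∨ pos 1 q + 1 = pos 0 r := by
      simp only [pos, Fin.val_zero, Fin.val_one]; split <;> split <;> omega
    have adj : (outputGraph D).Adj (w.getVert (pos 0 r)) (w.getVert (pos 1 q)) := by
      rcases hstep with e | e
      · rw [← e]; exact w.adj_getVert_succ (by omega)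
      · rw [← e]; exact (w.adj_getVert_succ (by omega)).symm
    have s0 := parity w (pos 0 r) (by omega)
    have s1 := parity w (pos 1 q) (by omega)
    obtain ⟨-, τ, hτ, t0, t1⟩ := adj
    rw [show (w.getVert (pos 0 r)).1 = 0 from Fin.ext (by simp [s0, p0])] at t0
    rw [show (w.getVert (pos 1 q)).1 = 1 from Fin.ext (by simp [s1, p1])] at t1
    exact ⟨τ, hτ, by rw [t0], by rw [t1]⟩

theorem RegAlgorithm.exists_outputTable {In : Type u} {Out : Type v} {V : Type x}
    {A : RegAlgorithm.{u, v, w, x} 2 In Out V} {r₀ : Fin 2 → V} {P : DistTask 2 In Out}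
    (h : (A.toSystem r₀).SolvesWaitFree P) :
    ∃ solo : Fin 2 → In → Option Out, ∀ σ ∈ P.inputs,
      ∃ (L : ℕ) (y : Fin 2 → ℕ → Option Out), (∀ i, y i 0 = solo i (σ i)) ∧
        ∀ r q, r ≤ L + 1 → q ≤ L + 1 → (r = q + 1 ∨ q = r + 1 ∨ (r = L + 1 ∧ q = L + 1)) →
          ∃ τ ∈ P.Δ σ, y 0 r = some (τ 0) ∧ y 1 q = some (τ 1) := by
  have hI := A.irrevocable r₀
  -- A process running alone never sees the other input, which may therefore be replaced by `x`. The
  -- constant configuration need not be an input of the task, so its solo execution may never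
  -- decide; hence the `none`.
  have hsolo : ∀ i x, ∃ o : Option Out, ∀ (σ : Fin 2 → In) a, σ i = x →
      (A.toSystem r₀).SoloDecides i ((A.toSystem r₀).start σ) a → o = some a := by
    intro i x
    by_cases hx : ∃ a, (A.toSystem r₀).SoloDecides i ((A.toSystem r₀).start fun _ => x) a
    · obtain ⟨a, ha⟩ := hx
      refine ⟨some a, fun σ b hσ hb => congrArg some (hI.soloDecides_unique ha ?_)⟩
      exact A.soloDecides_congr r₀ (c := (A.toSystem r₀).start σ)
        (d := (A.toSystem r₀).start fun _ => x) rfl (congrArg (A.init i) hσ) hb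
    · refine ⟨none, fun σ b hσ hb => (hx ⟨b, ?_⟩).elim⟩
      exact A.soloDecides_congr r₀ (c := (A.toSystem r₀).start σ)
        (d := (A.toSystem r₀).start fun _ => x) rfl (congrArg (A.init i) hσ) hb
  choose solo hsolo using hsolo
  refine ⟨solo, fun σ hσ => ?_⟩
  have hs := h.solvesFrom_start hσ
  obtain ⟨a, ha⟩ := hs.exists_soloDecides 0
  obtain ⟨b, hb⟩ := hs.exists_soloDecides 1
  obtain ⟨L, y, h0, h1, hy⟩ := _root_.exists_outputTable
    (hs.soloConnected hI soloConnected_of_step a b ha hb)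
  refine ⟨L, y, fun i => ?_, hy⟩
  match i with
  | 0 => rw [h0, hsolo 0 _ σ a rfl ha]
  | 1 => rw [h1, hsolo 1 _ σ b rfl hb]

/-! ### The 1-bit algorithm -/

/-- The local states of the 1-bit algorithm, after the first step. In round `0` a process writes its
input and reads the other input; in round `r`, between `1` and the last round, it writes the parity
of `r` and reads the other bit. It halts in the first round in which it does not read what it wrote
(in round `0`: in which it reads no input). From round `1` on, both inputs are known. -/
inductive ParityState (In : Type u) : Type u
  | readInput (a : In)
  | solo (a : In)
  | write (σ : Fin 2 → In) (r : ℕ)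
  | read (σ : Fin 2 → In) (r : ℕ)
  | halt (σ : Fin 2 → In) (r : ℕ)

/-- Enter round `r`, or halt if the last round is over. -/
def ParityState.enter {In : Type u} (L : (Fin 2 → In) → ℕ) (σ : Fin 2 → In) (r : ℕ) :
    ParityState In :=
  if r ≤ L σ then .write σ r else .halt σ r

/-- The 1-bit algorithm with last round `L σ` for inputs `σ`, in which a process halts in round `0`
with output `solo i a`, where `a` is its input, and in a later round `r` with output `y σ i r`; if
that is `none`, the process does not decide. -/
abbrev parityAlgorithm {In : Type u} {Out : Type v} (L : (Fin 2 → In) → ℕ)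
    (solo : Fin 2 → In → Option Out) (y : (Fin 2 → In) → Fin 2 → ℕ → Option Out) :
    InputRegAlgorithm.{u, v, u, 0} 2 In Out Bool where
  State := ParityState In
  init _ a := .readInput a
  op i s :=
    match s with
    | .readInput a => .readInput (1 - i) fun o =>
      match o with
      | none => .solo a
      | some b => .enter L (fun k => if k = i then a else b) 1
    | .solo a =>
      match solo i a with
      | some v => .decide v
      | none => .read i fun _ => .solo a
    | .write σ r => .write (decide (r % 2 = 1)) (.read σ r)
    | .read σ r => .read (1 - i) fun b =>
      if b = decide (r % 2 = 1) then .enter L σ (r + 1) else .halt σ r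
    | .halt σ r =>
      match y σ i r with
      | some v => .decide v
      | none => .read i fun _ => .halt σ r

/-! ### Abstract dynamics of the rounds and its invariant -/

/-- The progress of a process: it is about to write or to read in round `r`, or it has halted in
round `r`. -/
inductive RoundPhase
  | write (r : ℕ)
  | read (r : ℕ)
  | halt (r : ℕ)

namespace RoundPhase

/-- The number of writes that a process has performed. -/
def writes (L : ℕ) : RoundPhase → ℕ
  | write r => r
  | read r => r + 1
  -- A process that halts in round `L + 1` has agreed up to round `L` and writes nothing more.
  | halt r => min r L + 1

/-- The bit in the register of a process that has performed `m` writes. -/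
def bit (m : ℕ) : Bool := decide ((m - 1) % 2 = 1)

/-- The phase at the beginning of round `r`. -/
def enter (L r : ℕ) : RoundPhase := if r ≤ L then write r else halt r

/-- What a process reads in round `r` agrees with what it wrote, if the other process has performed
`m` writes. -/
def agree (r m : ℕ) : Bool := if r = 0 then decide (m ≠ 0) else bit m == decide (r % 2 = 1)

/-- The phase after a step, if the other process has performed `m` writes. -/
def next (L m : ℕ) : RoundPhase → RoundPhase
  | write r => read r
  | read r => if agree r m then enter L (r + 1) else halt r
  | halt r => halt r

/-- The round is not beyond the last one. -/
def Valid (L : ℕ) : RoundPhase → Prop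
  | write r => r ≤ L
  | read r => r ≤ L
  | halt r => r ≤ L + 1

/-- A measure of progress. -/
def rank (L : ℕ) : RoundPhase → ℕ
  | write r => 2 * r
  | read r => 2 * r + 1
  | halt _ => 2 * L + 2

/-- The pairs of phases that two processes can be in at the same time. -/
def Compatible (L : ℕ) : RoundPhase → RoundPhase → Prop
  | write r, write q => r = q
  | write r, read q => r = q ∨ r = q + 1
  | read r, write q => r = q ∨ q = r + 1
  | write r, halt q => r = q ∨ r = q + 1
  | halt r, write q => r = q ∨ q = r + 1
  | read r, read q => r ≤ q + 1 ∧ q ≤ r + 1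
  | read r, halt q => r ≤ q + 1 ∧ q ≤ r + 1
  | halt r, read q => r ≤ q + 1 ∧ q ≤ r + 1
  | halt r, halt q => r = q + 1 ∨ q = r + 1 ∨ (r = L + 1 ∧ q = L + 1)

theorem Compatible.symm {L : ℕ} {p q : RoundPhase} (h : Compatible L p q) : Compatible L q p := by
  cases p <;> cases q <;> simp only [Compatible] at h ⊢ <;> omega

theorem Valid.next {L : ℕ} {p : RoundPhase} (h : p.Valid L) (m : ℕ) : (p.next L m).Valid L := by
  cases p with
  | write r => exact h
  | halt r => exact h
  | read r =>
    simp only [RoundPhase.next, enter]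
    cases agree r m
    · exact Nat.le_succ_of_le h
    · rw [if_pos rfl]
      split
      · assumption
      · exact Nat.succ_le_succ h

theorem Valid.writes_next_read {L r : ℕ} (h : (read r).Valid L) (m : ℕ) :
    ((read r).next L m).writes L = r + 1 := by
  simp only [RoundPhase.next, enter, Valid] at h ⊢
  cases agree r m
  · simp only [Bool.false_eq_true, if_false, writes]; omega
  · rw [if_pos rfl]; split <;> simp only [writes]; omega

/-- The delicate case is a read in round `r`. A reader cannot tell whether a disagreeing partner is
behind or ahead, and need not: in both cases the partner can only halt in round `r - 1` or `r + 1`.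
-/
theorem Compatible.next {L : ℕ} {p q : RoundPhase} (h : Compatible L p q) (hp : p.Valid L)
    (hq : q.Valid L) : Compatible L (p.next L (q.writes L)) q := by
  cases p with
  | write r =>
    cases q <;> simp only [Compatible, RoundPhase.next, Valid] at * <;> omega
  | halt r => exact h
  | read r =>
    -- After `r + 1` writes the partner's last write was in round `r`; parity separates this from
    -- its two neighbours. Round `0` only tests whether an input is present, so `m = 2` passes there
    -- too.
    have hcond : ∀ m, (m = r ∨ m = r + 1 ∨ m = r + 2) →
        (agree r m ↔ (m = r + 1 ∨ (r = 0 ∧ m = 2))) := by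
      intro m hm
      unfold agree
      split
      · rw [decide_eq_true_iff]
        omega
      · simp only [bit, beq_iff_eq, decide_eq_decide]
        omega
    have hm : q.writes L = r ∨ q.writes L = r + 1 ∨ q.writes L = r + 2 := by
      cases q <;> simp only [Compatible, writes, Valid] at * <;> omega
    have hc := hcond _ hm
    clear hcond
    simp only [RoundPhase.next, enter]
    by_cases hb : agree r (q.writes L)
    · rw [if_pos hb]
      replace hc := hc.1 hb
      split <;> cases q <;> simp only [Compatible, Valid, writes] at * <;> omega
    · rw [if_neg hb]
      replace hc := mt hc.2 hb
      clear hb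
      cases q <;> simp only [Compatible, Valid, writes] at * <;> omega

theorem Valid.rank_lt_rank_next {L : ℕ} {p : RoundPhase} (hp : p.Valid L) (m : ℕ)
    (h : ∀ r, p ≠ halt r) : p.rank L < (p.next L m).rank L := by
  cases p with
  | write r => simp [RoundPhase.next, rank]
  | halt r => exact (h r rfl).elim
  | read r =>
    simp only [Valid] at hp
    simp only [RoundPhase.next, enter]
    cases agree r m
    · simp only [Bool.false_eq_true, if_false, rank]; omega
    · rw [if_pos rfl]; split <;> simp only [rank] <;> omega

theorem Valid.rank_le {L : ℕ} {p : RoundPhase} (hp : p.Valid L) : p.rank L ≤ 2 * L + 2 := by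
  cases p <;> simp only [Valid, rank] at * <;> omega

/-- The local state of process `i` in a given phase of an execution with inputs `σ`. -/
def loc {In : Type u} (σ : Fin 2 → In) (i : Fin 2) : RoundPhase → In ⊕ ParityState In
  | write 0 => .inl (σ i)
  | write (r + 1) => .inr (.write σ (r + 1))
  | read 0 => .inr (.readInput (σ i))
  | read (r + 1) => .inr (.read σ (r + 1))
  | halt 0 => .inr (.solo (σ i))
  | halt (r + 1) => .inr (.halt σ (r + 1))

/-- The global configuration in which the processes are in given phases. -/
def config {In : Type u} (L : ℕ) (σ : Fin 2 → In) (p : Fin 2 → RoundPhase) :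
    InputRegConfig 2 In Bool (ParityState In) where
  reg i := bit ((p i).writes L)
  inp i := if (p i).writes L = 0 then none else some (σ i)
  loc i := (p i).loc σ i

theorem config_update {In : Type u} (L : ℕ) (σ : Fin 2 → In) (p : Fin 2 → RoundPhase) (i : Fin 2)
    (q : RoundPhase) : config L σ (Function.update p i q) =
      { reg := Function.update (config L σ p).reg i (bit (q.writes L))
        inp := Function.update (config L σ p).inp i
          (if q.writes L = 0 then none else some (σ i))
        loc := Function.update (config L σ p).loc i (q.loc σ i) } := by
  simp only [config, InputRegConfig.mk.injEq]
  refine ⟨?_, ?_, ?_⟩ <;> funext k <;> by_cases hk : k = i <;> (try subst hk) <;> simp [*]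

theorem loc_enter {In : Type u} (L : (Fin 2 → In) → ℕ) (σ : Fin 2 → In) (i : Fin 2) (r : ℕ) :
    (enter (L σ) (r + 1)).loc σ i = .inr (.enter L σ (r + 1)) := by
  unfold enter ParityState.enter
  split <;> rfl

end RoundPhase

/-! ### Correctness of the 1-bit algorithm -/

namespace parityAlgorithm

open RoundPhase

variable {In : Type u} {Out : Type v} (L : (Fin 2 → In) → ℕ) (solo : Fin 2 → In → Option Out)
  (y : (Fin 2 → In) → Fin 2 → ℕ → Option Out) (σ : Fin 2 → In)

/-- The simulation step: the registers depend only on numbers of writes, so the phases evolve by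
`next` alone, independently of the outputs in the table. -/
theorem step_config (p : Fin 2 → RoundPhase) (i : Fin 2) (hp : (p i).Valid (L σ)) :
    (parityAlgorithm L solo y).step i (config (L σ) σ p) =
      config (L σ) σ (Function.update p i ((p i).next (L σ) ((p (1 - i)).writes (L σ)))) := by
  have hloc : (config (L σ) σ p).loc i = (p i).loc σ i := rfl
  have hreg : (config (L σ) σ p).reg i = bit ((p i).writes (L σ)) := rfl
  have hinp : (config (L σ) σ p).inp i =
    if (p i).writes (L σ) = 0 then none else some (σ i) := rfl
  have hreg' : (config (L σ) σ p).reg (1 - i) = bit ((p (1 - i)).writes (L σ)) := rfl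
  have hinp' : (config (L σ) σ p).inp (1 - i) =
    if (p (1 - i)).writes (L σ) = 0 then none else some (σ (1 - i)) := rfl
  rw [config_update]
  have upd_reg : ∀ q : RoundPhase, q.writes (L σ) = (p i).writes (L σ) →
      Function.update (config (L σ) σ p).reg i (bit (q.writes (L σ))) =
        (config (L σ) σ p).reg := fun q hq => by
    rw [hq, ← hreg, Function.update_eq_self]
  have upd_inp : ∀ q : RoundPhase, q.writes (L σ) = (p i).writes (L σ) →
      Function.update (config (L σ) σ p).inp i
        (if q.writes (L σ) = 0 then none else some (σ i)) = (config (L σ) σ p).inp := fun q hq => by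
    rw [hq, ← hinp, Function.update_eq_self]
  match e : p i with
  | .write 0 =>
    -- Round `0` writes the input and leaves the bit alone: by truncated subtraction, `bit 1` and
    -- `bit 0` are both the initial `false`.
    have hr : Function.update (config (L σ) σ p).reg i (bit 1) = (config (L σ) σ p).reg := by
      rw [show bit 1 = (config (L σ) σ p).reg i by rw [hreg, e]; rfl, Function.update_eq_self]
    replace hloc : (config (L σ) σ p).loc i = .inl (σ i) := hloc.trans (by rw [e]; rfl)
    simp only [InputRegAlgorithm.step, hloc, RoundPhase.next, writes, hr]
    rfl
  | .write (r + 1) =>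
    have hi : Function.update (config (L σ) σ p).inp i (some (σ i)) = (config (L σ) σ p).inp := by
      rw [show some (σ i) = (config (L σ) σ p).inp i by rw [hinp, e]; rfl, Function.update_eq_self]
    replace hloc : (config (L σ) σ p).loc i = .inr (.write σ (r + 1)) := hloc.trans (by rw [e]; rfl)
    simp only [InputRegAlgorithm.step, hloc, RoundPhase.next, writes, bit, Nat.add_one_sub_one,
      Nat.add_eq_zero_iff, one_ne_zero, and_false, if_false, hi]
    rfl
  | .read 0 =>
    replace hloc : (config (L σ) σ p).loc i = .inr (.readInput (σ i)) :=
      hloc.trans (by rw [e]; rfl)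
    rw [e] at hp upd_reg upd_inp
    have hw := hp.writes_next_read ((p (1 - i)).writes (L σ))
    rw [upd_reg _ hw, upd_inp _ hw]
    simp only [InputRegAlgorithm.step, hloc, RoundPhase.next, hinp']
    by_cases h0 : (p (1 - i)).writes (L σ) = 0
    · simp [h0, agree, RoundPhase.loc]
    · have hσ : (fun k => if k = i then σ i else σ (1 - i)) = σ := by
        funext k
        split
        · next h => rw [h]
        · next h => rw [show 1 - i = k by omega]
      rw [if_neg h0, if_pos (by simpa [agree] using h0), loc_enter]
      simp only [hσ, zero_add]
  | .read (r + 1) =>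
    replace hloc : (config (L σ) σ p).loc i = .inr (.read σ (r + 1)) := hloc.trans (by rw [e]; rfl)
    rw [e] at hp upd_reg upd_inp
    have hw := hp.writes_next_read ((p (1 - i)).writes (L σ))
    rw [upd_reg _ hw, upd_inp _ hw]
    simp only [InputRegAlgorithm.step, hloc, RoundPhase.next, hreg']
    by_cases hb : bit ((p (1 - i)).writes (L σ)) = decide ((r + 1) % 2 = 1)
    · rw [if_pos hb, if_pos (by simpa [agree] using hb), loc_enter]
    · rw [if_neg hb, if_neg (by simpa [agree] using hb)]
      rfl
  | .halt r =>
    have hself : Function.update (config (L σ) σ p).loc i ((halt r).loc σ i) =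
        (config (L σ) σ p).loc := by
      rw [← e, ← hloc, Function.update_eq_self]
    have hnext : (halt r).next (L σ) ((p (1 - i)).writes (L σ)) = halt r := rfl
    rw [hnext, upd_reg _ (by rw [e]), upd_inp _ (by rw [e]), hself]
    rw [e] at hloc
    cases r with
    | zero =>
      simp only [RoundPhase.loc] at hloc hself
      simp only [InputRegAlgorithm.step, hloc]
      cases solo i (σ i) <;> simp only [hself]
    | succ r =>
      simp only [RoundPhase.loc] at hloc hself
      simp only [InputRegAlgorithm.step, hloc]
      cases y σ i (r + 1) <;> simp only [hself]

theorem output_config (hy : ∀ i, y σ i 0 = solo i (σ i)) (p : Fin 2 → RoundPhase) (i : Fin 2) :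
    (parityAlgorithm L solo y).output i (config (L σ) σ p) =
      match p i with
      | .halt r => y σ i r
      | _ => none := by
  have hloc : (config (L σ) σ p).loc i = (p i).loc σ i := rfl
  match e : p i with
  | .write 0 | .write (r + 1) | .read 0 | .read (r + 1) =>
    rw [e] at hloc
    simp [InputRegAlgorithm.output, hloc, RoundPhase.loc]
  | .halt 0 =>
    rw [e] at hloc
    simp only [InputRegAlgorithm.output, hloc, RoundPhase.loc, hy]
    cases solo i (σ i) <;> rfl
  | .halt (r + 1) =>
    rw [e] at hloc
    simp only [InputRegAlgorithm.output, hloc, RoundPhase.loc]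
    cases y σ i (r + 1) <;> rfl

/-- The phases of the processes after `t` steps of the schedule `ρ`. -/
def phases (L : ℕ) (ρ : ℕ → Fin 2) : ℕ → Fin 2 → RoundPhase
  | 0 => fun _ => .write 0
  | t + 1 => Function.update (phases L ρ t) (ρ t)
      ((phases L ρ t (ρ t)).next L ((phases L ρ t (1 - ρ t)).writes L))

theorem phases_valid (L : ℕ) (ρ : ℕ → Fin 2) (t : ℕ) (i : Fin 2) : (phases L ρ t i).Valid L := by
  induction t generalizing i with
  | zero => exact Nat.zero_le _
  | succ t ih =>
    unfold phases
    by_cases h : i = ρ t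
    · rw [h, Function.update_self]
      exact (ih _).next _
    · rw [Function.update_of_ne h]
      exact ih i

theorem phases_compatible (L : ℕ) (ρ : ℕ → Fin 2) (t : ℕ) (i : Fin 2) :
    Compatible L (phases L ρ t i) (phases L ρ t (1 - i)) := by
  induction t generalizing i with
  | zero => simp [phases, Compatible]
  | succ t ih =>
    have key := (ih (ρ t)).next (phases_valid L ρ t _) (phases_valid L ρ t _)
    have hne : 1 - ρ t ≠ ρ t := by omega
    unfold phases
    by_cases h : i = ρ t
    · rw [h, Function.update_self, Function.update_of_ne hne]
      exact key
    · obtain rfl : i = 1 - ρ t := by omega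
      rw [Function.update_of_ne hne, show 1 - (1 - ρ t) = ρ t by omega, Function.update_self]
      exact key.symm

theorem exec_eq (ρ : ℕ → Fin 2) (t : ℕ) :
    ((parityAlgorithm L solo y).toSystem fun _ => false).exec σ ρ t =
      config (L σ) σ (phases (L σ) ρ t) := by
  induction t with
  | zero => rfl
  | succ t ih =>
    rw [AsyncSystem.exec, ih]
    exact step_config L solo y σ _ _ (phases_valid _ _ _ _)

/-- Until process `i` halts, each of its steps increases `rank`, which is bounded, and steps of the
other process leave it unchanged. -/
theorem exists_halt (L : ℕ) (ρ : ℕ → Fin 2) (i : Fin 2) (hi : ∀ t, ∃ t', t ≤ t' ∧ ρ t' = i) :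
    ∃ t r, phases L ρ t i = .halt r := by
  by_contra! hno
  have lt : ∀ t, ρ t = i → (phases L ρ t i).rank L < (phases L ρ (t + 1) i).rank L := by
    rintro t rfl
    rw [phases, Function.update_self]
    exact (phases_valid L ρ t _).rank_lt_rank_next _ (hno t)
  have mono : Monotone fun t => (phases L ρ t i).rank L := monotone_nat_of_le_succ fun t => by
    by_cases h : ρ t = i
    · exact (lt t h).le
    · rw [phases, Function.update_of_ne (Ne.symm h)]
  have unbounded : ∀ m, ∃ t, m ≤ (phases L ρ t i).rank L := by
    intro m
    induction m with
    | zero => exact ⟨0, Nat.zero_le _⟩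
    | succ m ih =>
      obtain ⟨t, ht⟩ := ih
      obtain ⟨t', h, e⟩ := hi t
      exact ⟨t' + 1, (ht.trans (mono h)).trans_lt (lt t' e)⟩
  obtain ⟨t, ht⟩ := unbounded (2 * L + 3)
  have := (phases_valid L ρ t i).rank_le
  omega

/-- The 1-bit algorithm solves a task if the outputs in rounds in which the two processes can halt
are legal together. -/
theorem solvesWaitFree (P : DistTask 2 In Out)
    (hsolo : ∀ σ ∈ P.inputs, ∀ i, y σ i 0 = solo i (σ i))
    (hlegal : ∀ σ ∈ P.inputs, ∀ r q, r ≤ L σ + 1 → q ≤ L σ + 1 →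
      (r = q + 1 ∨ q = r + 1 ∨ (r = L σ + 1 ∧ q = L σ + 1)) →
        ∃ τ ∈ P.Δ σ, y σ 0 r = some (τ 0) ∧ y σ 1 q = some (τ 1)) :
    ((parityAlgorithm L solo y).toSystem fun _ => false).SolvesWaitFree P := by
  intro σ hσ ρ
  have houtput : ∀ i t, ((parityAlgorithm L solo y).toSystem fun _ => false).output i
      (((parityAlgorithm L solo y).toSystem fun _ => false).exec σ ρ t) =
        match phases (L σ) ρ t i with
        | .halt r => y σ i r
        | _ => none := fun i t => by
    rw [exec_eq]
    exact output_config L solo y σ (hsolo σ hσ) _ i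
  -- If only one process has halted, an adjacent round supplies a legal partner output; one exists
  -- even for `L σ = 0`, as rounds go up to `L σ + 1`.
  have neighbour : ∀ r, r ≤ L σ + 1 → ∃ q, q ≤ L σ + 1 ∧ (r = q + 1 ∨ q = r + 1) := fun r hr => by
    cases r with
    | zero => exact ⟨1, by omega, by omega⟩
    | succ r => exact ⟨r, by omega, by omega⟩
  refine ⟨fun t => ?_, fun i hi => ?_⟩
  · have hc := phases_compatible (L σ) ρ t 0
    have h0 := phases_valid (L σ) ρ t 0
    have h1 := phases_valid (L σ) ρ t 1
    have o0 := houtput 0 t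
    have o1 := houtput 1 t
    rw [show (1 - 0 : Fin 2) = 1 from rfl] at hc
    have finish : ∀ r q, r ≤ L σ + 1 → q ≤ L σ + 1 →
        (r = q + 1 ∨ q = r + 1 ∨ (r = L σ + 1 ∧ q = L σ + 1)) →
        (∀ k, phases (L σ) ρ t 0 = .halt k → k = r) →
        (∀ k, phases (L σ) ρ t 1 = .halt k → k = q) →
        ((parityAlgorithm L solo y).toSystem fun _ => false).Legal P σ
          (((parityAlgorithm L solo y).toSystem fun _ => false).exec σ ρ t) := by
      intro r q hr hq hrq k0 k1
      obtain ⟨τ, hτ, e0, e1⟩ := hlegal σ hσ r q hr hq hrq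
      refine ⟨τ, hτ, fun i a ha => ?_⟩
      match i with
      | 0 =>
        rw [o0] at ha
        split at ha
        · next k hk =>
          rw [k0 k hk, e0] at ha
          exact Option.some.inj ha
        · cases ha
      | 1 =>
        rw [o1] at ha
        split at ha
        · next k hk =>
          rw [k1 k hk, e1] at ha
          exact Option.some.inj ha
        · cases ha
    match c0 : phases (L σ) ρ t 0, c1 : phases (L σ) ρ t 1 with
    | .halt r, .halt q =>
      rw [c0] at h0 hc
      rw [c1] at h1 hc
      exact finish r q h0 h1 hc (by simp [c0]) (by simp [c1])
    | .halt r, .write _ | .halt r, .read _ =>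
      rw [c0] at h0
      obtain ⟨q, hq, hrq⟩ := neighbour r h0
      exact finish r q h0 hq (by omega) (by simp [c0]) (by simp [c1])
    | .write _, .halt q | .read _, .halt q =>
      rw [c1] at h1
      obtain ⟨r, hr, hrq⟩ := neighbour q h1
      exact finish r q hr h1 (by omega) (by simp [c0]) (by simp [c1])
    | .write _, .write _ | .write _, .read _ | .read _, .write _ | .read _, .read _ =>
      -- Nobody has halted, so any pair of adjacent rounds serves.
      exact finish 0 1 (by omega) (by omega) (by omega) (by simp [c0]) (by simp [c1])
  · obtain ⟨t, r, hr⟩ := exists_halt (L σ) ρ i hi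
    have hv := phases_valid (L σ) ρ t i
    have ho := houtput i t
    rw [hr] at hv ho
    obtain ⟨q, hq, hrq⟩ := neighbour r hv
    refine ⟨t, ?_⟩
    match i with
    | 0 =>
      obtain ⟨τ, -, e, -⟩ := hlegal σ hσ r q hv hq (by omega)
      exact ⟨τ 0, ho.trans e⟩
    | 1 =>
      obtain ⟨τ, -, -, e⟩ := hlegal σ hσ q r hq hv (by omega)
      exact ⟨τ 1, ho.trans e⟩

end parityAlgorithm

theorem theorem2 {In : Type u} {Out : Type v} (P : DistTask 2 In Out)
    (h : DistTask.SolvableUnbounded.{u, v, w, x} P) : DistTask.SolvableOneBit.{u, v, u} P := by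
  obtain ⟨V, r₀, A, hA⟩ := h
  obtain ⟨solo, hsolo⟩ := A.exists_outputTable hA
  choose! L y hy using hsolo
  exact ⟨parityAlgorithm L solo y, parityAlgorithm.solvesWaitFree L solo y P
    (fun σ hσ => (hy σ hσ).1) (fun σ hσ => (hy σ hσ).2)⟩
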